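/- A real square matrix $A$ is called nonnegative if all its entries are nonnegative, and bisymmetric if it is symmetric ($A=A^T$) and persymmetric ($AJ=JA^T$, where $J$ is the matrix with ones on the antidiagonal and zeros elsewhere). Let $\lambda_1\ge\lambda_2\ge\lambda_3\ge\lambda_4\ge\lambda_5\ge-\lambda_1$ be real numbers with $\sum_{i=1}^5\lambda_i=0$. Then $\lambda_1,\dots,\lambda_5$ are the eigenvalues, counted with multiplicity, of a $5\times5$ nonnegative bisymmetric matrix if and only if $$\lambda_2+\lambda_5\le 0\quad\text{and}\quad\sum_{i=1}^5\lambda_i^3\ge 0.$$ The same two inequalities are also necessary and sufficient for $\lambda_1,\dots,\lambda_5$ to be the eigenvalues, counted with multiplicity, of a $5\times5$ nonnegative symmetric matrix. -/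

import Mathlib

/-- The reverse identity matrix `J`: ones on the antidiagonal, zeros elsewhere. -/
def reverseIdentity (n : ℕ) : Matrix (Fin n) (Fin n) ℝ :=
  Matrix.of fun i j => if j = Fin.rev i then 1 else 0

/-- `A` is persymmetric: `A J = J Aᵀ`. -/
def IsPersymmetric {n : ℕ} (A : Matrix (Fin n) (Fin n) ℝ) : Prop :=
  A * reverseIdentity n = reverseIdentity n * A.transpose

/-- `A` is bisymmetric: symmetric and persymmetric (hence also centrosymmetric, `A J = J A`). -/
def IsBisymmetric {n : ℕ} (A : Matrix (Fin n) (Fin n) ℝ) : Prop :=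
  A.IsSymm ∧ IsPersymmetric A

/-- `A` is a nonnegative matrix: all its entries are nonnegative. -/
def IsNonnegMatrix {n : ℕ} (A : Matrix (Fin n) (Fin n) ℝ) : Prop :=
  ∀ i j, 0 ≤ A i j

/-- The multiset `s` is the list of eigenvalues of `A`, with algebraic multiplicities: all `n` of
the eigenvalues are accounted for, and they are the roots of the characteristic polynomial. -/
def HasSpectrum {n : ℕ} (A : Matrix (Fin n) (Fin n) ℝ) (s : Multiset ℝ) : Prop :=
  s.card = n ∧ A.charpoly.roots = s

open Matrix

/-! Necessity. The sum of cubes is `tr A³`. Trace zero and nonnegativity make the diagonal vanish.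
Of two orthogonal eigenvectors for `l₁`, `l₂`, one has, up to sign, one or two positive entries,
which forces an off-diagonal entry at least its eigenvalue `μ`; testing `A` on `eᵢ - eⱼ` gives `l₅ ≤
-μ ≤ -l₂`.

Sufficiency. A centrosymmetric matrix splits into blocks of sizes 2 and 3 on antisymmetric and
symmetric vectors. The spectrum is divided between the blocks according to the signs of `l₂` and
`l₃`, and `bisymmetricFive` is solved for its parameters. -/

/-! ### Necessity of the two inequalities. -/

theorem Matrix.IsSymm.isHermitian_real {n : Type*} {A : Matrix n n ℝ} (hA : A.IsSymm) :
    A.IsHermitian := by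
  rw [Matrix.IsHermitian, Matrix.conjTranspose_eq_transpose_of_trivial]
  exact hA

/-- If all eigenvalues of a real Hermitian matrix are at least `m`, then so are its Rayleigh
quotients. -/
theorem Matrix.IsHermitian.mul_dotProduct_le {n : Type*} [Fintype n] [DecidableEq n]
    {A : Matrix n n ℝ} (hA : A.IsHermitian) {m : ℝ} (hm : ∀ r ∈ A.charpoly.roots, m ≤ r)
    (x : n → ℝ) : m * (x ⬝ᵥ x) ≤ x ⬝ᵥ A *ᵥ x := by
  have hB : (A - algebraMap ℝ (Matrix n n ℝ) m).IsHermitian :=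
    hA.sub (by simp [Matrix.IsHermitian, Matrix.algebraMap_eq_diagonal])
  have hpos : (A - algebraMap ℝ (Matrix n n ℝ) m).PosSemidef := by
    rw [hB.posSemidef_iff_eigenvalues_nonneg]
    intro i
    have h := hB.eigenvalues_mem_spectrum_real i
    rw [← spectrum.sub_singleton_eq] at h
    obtain ⟨r, hr, c, hc, hrc⟩ := Set.mem_sub.1 h
    rw [Set.mem_singleton_iff] at hc
    have := hm r ((Polynomial.mem_roots (Matrix.charpoly_monic A).ne_zero).2
      (Matrix.mem_spectrum_iff_isRoot_charpoly.1 hr))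
    rw [Pi.zero_apply, ← hrc, hc]
    linarith
  have h := hpos.re_dotProduct_nonneg x
  simp only [star_trivial, RCLike.re_to_real, Matrix.sub_mulVec, dotProduct_sub,
    Algebra.algebraMap_eq_smul_one, Matrix.smul_mulVec, Matrix.one_mulVec, dotProduct_smul,
    smul_eq_mul] at h
  linarith

theorem Matrix.IsHermitian.sum_pow_roots_charpoly {n : Type*} [Fintype n] [DecidableEq n]
    {A : Matrix n n ℝ} (hA : A.IsHermitian) (k : ℕ) :
    (A.charpoly.roots.map (· ^ k)).sum = (A ^ k).trace := by
  have h : A ^ k = Unitary.conjStarAlgAut ℝ _ hA.eigenvectorUnitary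
      (diagonal (hA.eigenvalues ^ k)) := by
    conv_lhs => rw [hA.spectral_theorem, ← map_pow, Matrix.diagonal_pow]
    rfl
  rw [h, Unitary.conjStarAlgAut_apply, Matrix.trace_mul_comm, ← mul_assoc,
    Unitary.coe_star_mul_self, one_mul, Matrix.trace_diagonal, hA.roots_charpoly_eq_eigenvalues]
  simp

/-- An eigenvector of a nonnegative symmetric matrix of trace zero whose positive part has one or
two entries forces the smallest eigenvalue below the negative of its eigenvalue. -/
theorem le_neg_of_card_pos_le_two {n : Type*} [Fintype n] [DecidableEq n] {A : Matrix n n ℝ}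
    (hA : ∀ i j, 0 ≤ A i j) (hsymm : A.IsSymm) (hdiag : ∀ i, A i i = 0) {m : ℝ}
    (hm : ∀ x : n → ℝ, m * (x ⬝ᵥ x) ≤ x ⬝ᵥ A *ᵥ x) {w : n → ℝ} {μ : ℝ} (hμ : 0 < μ)
    (hw : A *ᵥ w = μ • w) (hne : 0 < ({i | 0 < w i} : Finset n).card)
    (hcard : ({i | 0 < w i} : Finset n).card ≤ 2) : m ≤ -μ := by
  -- In row `i` of `A w = μ w`, the diagonal term is zero and every term outside column `j` is
  -- nonpositive.
  have key : ∀ i j, (∀ k, 0 < w k → k = i ∨ k = j) → μ * w i ≤ A i j * w j := by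
    intro i j hij
    have h : μ * w i = ∑ k, A i k * w k := by
      have := congrFun hw i
      simpa [Matrix.mulVec, dotProduct] using this.symm
    rw [h, ← Finset.add_sum_erase _ _ (Finset.mem_univ j)]
    have : ∑ k ∈ Finset.univ.erase j, A i k * w k ≤ 0 := by
      refine Finset.sum_nonpos fun k hk => ?_
      by_cases hki : k = i
      · simp [hki, hdiag]
      · refine mul_nonpos_of_nonneg_of_nonpos (hA i k) (not_lt.1 fun hpos => ?_)
        rcases hij k hpos with h | h
        · exact hki h
        · exact (Finset.ne_of_mem_erase hk) h
    linarith
  have hcases : ({i | 0 < w i} : Finset n).card = 1 ∨ ({i | 0 < w i} : Finset n).card = 2 := by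
    omega
  rcases hcases with h1 | h2
  · obtain ⟨i, hi⟩ := Finset.card_eq_one.1 h1
    have hmem : ∀ k, 0 < w k ↔ k = i := fun k => by
      simpa using Finset.ext_iff.1 hi k
    have h := key i i fun k hk => Or.inl ((hmem k).1 hk)
    have hwi := (hmem i).2 rfl
    rw [hdiag, zero_mul] at h
    exact absurd h (not_le.2 (mul_pos hμ hwi))
  · obtain ⟨i, j, hij, hs⟩ := Finset.card_eq_two.1 h2
    have hmem : ∀ k, 0 < w k ↔ k = i ∨ k = j := fun k => by
      simpa using Finset.ext_iff.1 hs k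
    have hi := (hmem i).2 (Or.inl rfl)
    have hj := (hmem j).2 (Or.inr rfl)
    have h₁ := key i j fun k hk => (hmem k).1 hk
    have h₂ := key j i fun k hk => ((hmem k).1 hk).symm
    rw [hsymm.apply i j] at h₂
    have hle : μ ≤ A i j := by
      have : μ * (w i + w j) ≤ A i j * (w i + w j) := by linarith
      exact le_of_mul_le_mul_right this (by linarith)
    have hR := hm (Pi.single i 1 - Pi.single j 1)
    have e1 : (Pi.single i 1 - Pi.single j 1 : n → ℝ) ⬝ᵥ (Pi.single i 1 - Pi.single j 1) = 2 := by
      simp [dotProduct_sub, hij, hij.symm]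
      norm_num
    have e2 : (Pi.single i 1 - Pi.single j 1 : n → ℝ) ⬝ᵥ
        A *ᵥ (Pi.single i 1 - Pi.single j 1) = -2 * A i j := by
      simp [Matrix.mulVec_sub, dotProduct_sub, sub_dotProduct, hdiag, hsymm.apply i j]
      ring
    rw [e1, e2] at hR
    linarith

/-- The positive and negative supports are disjoint among five indices, so one has at most two
elements; if that one is empty, the vector has constant sign. -/
theorem exists_card_pos_le_two_or_nonneg {x : Fin 5 → ℝ} (hx : x ≠ 0) :
    ∃ w : Fin 5 → ℝ, (w = x ∨ w = -x) ∧ 0 < ({i | 0 < w i} : Finset (Fin 5)).card ∧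
      (({i | 0 < w i} : Finset (Fin 5)).card ≤ 2 ∨ ∀ i, 0 ≤ w i) := by
  have hdisj : Disjoint ({i | 0 < x i} : Finset (Fin 5)) ({i | 0 < (-x) i} : Finset (Fin 5)) := by
    rw [Finset.disjoint_filter]
    intro i _ h h'
    rw [Pi.neg_apply] at h'
    linarith
  have hle : ({i | 0 < x i} : Finset (Fin 5)).card +
      ({i | 0 < (-x) i} : Finset (Fin 5)).card ≤ 5 := by
    rw [← Finset.card_union_of_disjoint hdisj]
    exact Finset.card_le_univ _
  have hpos : 0 < ({i | 0 < x i} : Finset (Fin 5)).card +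
      ({i | 0 < (-x) i} : Finset (Fin 5)).card := by
    rw [← Finset.card_union_of_disjoint hdisj, Finset.card_pos]
    obtain ⟨i, hi⟩ := Function.ne_iff.1 hx
    refine ⟨i, ?_⟩
    rcases lt_or_gt_of_ne hi with h | h
    · simp only [Finset.mem_union, Finset.mem_filter, Pi.neg_apply]
      exact Or.inr ⟨Finset.mem_univ _, neg_pos.2 h⟩
    · simp only [Finset.mem_union, Finset.mem_filter]
      exact Or.inl ⟨Finset.mem_univ _, h⟩
  have hzero : ∀ y : Fin 5 → ℝ, ({i | 0 < (-y) i} : Finset (Fin 5)).card = 0 → ∀ i, 0 ≤ y i := by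
    intro y h i
    have := Finset.filter_eq_empty_iff.1 (Finset.card_eq_zero.1 h) (Finset.mem_univ i)
    simpa using this
  by_cases h0 : ({i | 0 < (-x) i} : Finset (Fin 5)).card = 0
  · exact ⟨x, Or.inl rfl, by omega, Or.inr (hzero x h0)⟩
  by_cases h2 : ({i | 0 < (-x) i} : Finset (Fin 5)).card ≤ 2
  · exact ⟨-x, Or.inr rfl, by omega, Or.inl h2⟩
  by_cases h0' : ({i | 0 < x i} : Finset (Fin 5)).card = 0
  · exact ⟨-x, Or.inr rfl, by omega, Or.inr (hzero (-x) (by rwa [neg_neg]))⟩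
  · exact ⟨x, Or.inl rfl, by omega, Or.inl (by omega)⟩

/-- Among two orthogonal nonzero vectors of length five, up to sign, one has a positive part with
one or two entries. -/
theorem exists_card_pos_le_two {x y : Fin 5 → ℝ} (hx : x ≠ 0) (hy : y ≠ 0) (hxy : x ⬝ᵥ y = 0) :
    ∃ w : Fin 5 → ℝ, (w = x ∨ w = -x ∨ w = y ∨ w = -y) ∧
      0 < ({i | 0 < w i} : Finset (Fin 5)).card ∧
      ({i | 0 < w i} : Finset (Fin 5)).card ≤ 2 := by
  obtain ⟨u, hu, hu0, hu2⟩ := exists_card_pos_le_two_or_nonneg hx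
  obtain ⟨v, hv, hv0, hv2⟩ := exists_card_pos_le_two_or_nonneg hy
  have huv : u ⬝ᵥ v = 0 := by
    rcases hu with rfl | rfl <;> rcases hv with rfl | rfl <;> simp [hxy]
  have hcu : u = x ∨ u = -x ∨ u = y ∨ u = -y := by tauto
  have hcv : v = x ∨ v = -x ∨ v = y ∨ v = -y := by tauto
  rcases hu2 with hu2 | hu2
  · exact ⟨u, hcu, hu0, hu2⟩
  rcases hv2 with hv2 | hv2
  · exact ⟨v, hcv, hv0, hv2⟩
  -- Orthogonal nonnegative vectors have disjoint supports.
  have hdisj : Disjoint ({i | 0 < u i} : Finset (Fin 5)) ({i | 0 < v i} : Finset (Fin 5)) := by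
    rw [Finset.disjoint_filter]
    intro i hi h h'
    have := (Finset.sum_eq_zero_iff_of_nonneg fun k _ => mul_nonneg (hu2 k) (hv2 k)).1 huv i hi
    exact (mul_pos h h').ne' this
  have hle : ({i | 0 < u i} : Finset (Fin 5)).card +
      ({i | 0 < v i} : Finset (Fin 5)).card ≤ 5 := by
    rw [← Finset.card_union_of_disjoint hdisj]
    exact Finset.card_le_univ _
  by_cases h : ({i | 0 < u i} : Finset (Fin 5)).card ≤ 2
  · exact ⟨u, hcu, hu0, h⟩
  · exact ⟨v, hcv, hv0, by omega⟩

/-- Distinct indices are needed even when `a = b`: they supply orthogonal eigenvectors when `l₁ =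
l₂`. -/
theorem exists_ne_of_map_eq_cons_cons {n α : Type*} [Fintype n] [DecidableEq n] {f : n → α}
    {a b : α} {s : Multiset α} (h : Finset.univ.val.map f = a ::ₘ b ::ₘ s) :
    ∃ i j, i ≠ j ∧ f i = a ∧ f j = b := by
  obtain ⟨i, -, hi⟩ := Multiset.mem_map.1 (h ▸ Multiset.mem_cons_self a _)
  have hu : (Finset.univ : Finset n).val = i ::ₘ (Finset.univ.erase i).val := by
    rw [Finset.erase_val, Multiset.cons_erase (Finset.mem_univ i)]
  rw [hu, Multiset.map_cons, hi, Multiset.cons_inj_right] at h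
  obtain ⟨j, hj, hj'⟩ := Multiset.mem_map.1 (h ▸ Multiset.mem_cons_self b _)
  exact ⟨i, j, (Finset.ne_of_mem_erase hj).symm, hi, hj'⟩

theorem add_nonpos_and_sum_cubes_nonneg {l₁ l₂ l₃ l₄ l₅ : ℝ}
    (h₁₂ : l₂ ≤ l₁) (h₂₃ : l₃ ≤ l₂) (h₃₄ : l₄ ≤ l₃) (h₄₅ : l₅ ≤ l₄)
    (hsum : l₁ + l₂ + l₃ + l₄ + l₅ = 0) {A : Matrix (Fin 5) (Fin 5) ℝ}
    (hA : IsNonnegMatrix A) (hsymm : A.IsSymm) (hspec : HasSpectrum A {l₁, l₂, l₃, l₄, l₅}) :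
    l₂ + l₅ ≤ 0 ∧ 0 ≤ l₁ ^ 3 + l₂ ^ 3 + l₃ ^ 3 + l₄ ^ 3 + l₅ ^ 3 := by
  have hH := hsymm.isHermitian_real
  obtain ⟨-, hroots⟩ := hspec
  refine ⟨?_, ?_⟩
  · have htr : A.trace = 0 := by
      have := hH.sum_pow_roots_charpoly 1
      rw [hroots] at this
      simp at this
      linarith
    have hdiag : ∀ i, A i i = 0 := fun i =>
      (Finset.sum_eq_zero_iff_of_nonneg fun k _ => hA k k).1 htr i (Finset.mem_univ i)
    have hm := hH.mul_dotProduct_le (m := l₅) (by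
      intro r hr
      rw [hroots] at hr
      simp at hr
      rcases hr with rfl | rfl | rfl | rfl | rfl <;> linarith)
    by_contra! hlt
    have h2 : 0 < l₂ := by linarith
    have h := hH.roots_charpoly_eq_eigenvalues
    rw [hroots] at h
    obtain ⟨i, j, hij, hi, hj⟩ := exists_ne_of_map_eq_cons_cons
      (f := hH.eigenvalues) h.symm
    have hne : ∀ k, (hH.eigenvectorBasis k : Fin 5 → ℝ) ≠ 0 := fun k h0 =>
      hH.eigenvectorBasis.orthonormal.ne_zero k ((WithLp.ofLp_eq_zero 2).1 h0)
    have horth : (hH.eigenvectorBasis i : Fin 5 → ℝ) ⬝ᵥ (hH.eigenvectorBasis j) = 0 := by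
      have : inner ℝ (hH.eigenvectorBasis i) (hH.eigenvectorBasis j) = 0 :=
        hH.eigenvectorBasis.orthonormal.2 hij
      rw [EuclideanSpace.inner_eq_star_dotProduct, dotProduct_comm] at this
      simpa using this
    have hvi := hH.mulVec_eigenvectorBasis i
    have hvj := hH.mulVec_eigenvectorBasis j
    rw [hi] at hvi
    rw [hj] at hvj
    obtain ⟨w, hw, hw0, hw2⟩ := exists_card_pos_le_two (hne i) (hne j) horth
    have : l₅ ≤ -l₁ ∨ l₅ ≤ -l₂ := by
      rcases hw with rfl | rfl | rfl | rfl
      · exact Or.inl (le_neg_of_card_pos_le_two hA hsymm hdiag hm (by linarith) hvi hw0 hw2)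
      · exact Or.inl (le_neg_of_card_pos_le_two hA hsymm hdiag hm (by linarith)
          (by rw [Matrix.mulVec_neg, hvi, smul_neg]) hw0 hw2)
      · exact Or.inr (le_neg_of_card_pos_le_two hA hsymm hdiag hm h2 hvj hw0 hw2)
      · exact Or.inr (le_neg_of_card_pos_le_two hA hsymm hdiag hm h2
          (by rw [Matrix.mulVec_neg, hvj, smul_neg]) hw0 hw2)
    rcases this with h | h <;> linarith
  · have h3 := hH.sum_pow_roots_charpoly 3
    rw [hroots] at h3
    have hnn : 0 ≤ (A ^ 3).trace := by
      simp only [pow_three, Matrix.trace, Matrix.diag_apply, Matrix.mul_apply]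
      refine Finset.sum_nonneg fun i _ => Finset.sum_nonneg fun j _ => mul_nonneg (hA i j) ?_
      exact Finset.sum_nonneg fun k _ => mul_nonneg (hA j k) (hA k i)
    simp at h3
    linarith

/-! ### Construction of the bisymmetric matrices. -/

/-- A bisymmetric `5 × 5` matrix, orthogonally similar to the direct sum of
`!![-a, s; s, -b]` and `!![0, √2 * x, √2 * y; √2 * x, a, t; √2 * y, t, b]`. -/
noncomputable def bisymmetricFive (a b s t x y : ℝ) : Matrix (Fin 5) (Fin 5) ℝ :=
  !![0, (t + s) / 2, x, (t - s) / 2, a;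
     (t + s) / 2, 0, y, b, (t - s) / 2;
     x, y, 0, y, x;
     (t - s) / 2, b, y, 0, (t + s) / 2;
     a, (t - s) / 2, x, (t + s) / 2, 0]

theorem bisymmetricFive_isSymm (a b s t x y : ℝ) : (bisymmetricFive a b s t x y).IsSymm := by
  ext i j
  fin_cases i <;> fin_cases j <;> rfl

theorem mul_reverseIdentity_apply {n : ℕ} (A : Matrix (Fin n) (Fin n) ℝ) (i j : Fin n) :
    (A * reverseIdentity n) i j = A i j.rev := by
  simp [Matrix.mul_apply, reverseIdentity, eq_comm (a := j), Fin.rev_eq_iff]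

theorem reverseIdentity_mul_apply {n : ℕ} (A : Matrix (Fin n) (Fin n) ℝ) (i j : Fin n) :
    (reverseIdentity n * A) i j = A i.rev j := by
  simp [Matrix.mul_apply, reverseIdentity]

theorem bisymmetricFive_isBisymmetric (a b s t x y : ℝ) :
    IsBisymmetric (bisymmetricFive a b s t x y) := by
  refine ⟨bisymmetricFive_isSymm a b s t x y, ?_⟩
  rw [IsPersymmetric, (bisymmetricFive_isSymm a b s t x y).eq]
  ext i j
  rw [mul_reverseIdentity_apply, reverseIdentity_mul_apply]
  fin_cases i <;> fin_cases j <;> rfl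

theorem bisymmetricFive_isNonnegMatrix {a b s t x y : ℝ} (ha : 0 ≤ a) (hb : 0 ≤ b)
    (hst : |s| ≤ t) (hx : 0 ≤ x) (hy : 0 ≤ y) : IsNonnegMatrix (bisymmetricFive a b s t x y) := by
  obtain ⟨h₁, h₂⟩ := abs_le.1 hst
  have h₃ : 0 ≤ (t + s) / 2 := by linarith
  have h₄ : 0 ≤ (t - s) / 2 := by linarith
  intro i j
  fin_cases i <;> fin_cases j <;> simp [bisymmetricFive, *]

theorem eval_charpoly_bisymmetricFive (a b s t x y r : ℝ) :
    (bisymmetricFive a b s t x y).charpoly.eval r =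
      ((r + a) * (r + b) - s ^ 2) *
        (r * ((r - a) * (r - b) - t ^ 2) - 2 * x ^ 2 * (r - b) - 2 * y ^ 2 * (r - a)
          - 4 * x * y * t) := by
  have h : Matrix.scalar (Fin 5) r - bisymmetricFive a b s t x y =
      !![r, -((t + s) / 2), -x, -((t - s) / 2), -a;
         -((t + s) / 2), r, -y, -b, -((t - s) / 2);
         -x, -y, r, -y, -x;
         -((t - s) / 2), -b, -y, r, -((t + s) / 2);
         -a, -((t - s) / 2), -x, -((t + s) / 2), r] := by
    ext i j
    fin_cases i <;> fin_cases j <;> simp [bisymmetricFive]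
  rw [Matrix.eval_charpoly, h]
  eval_det
  ring

open Polynomial in
theorem hasSpectrum_of_eval_charpoly {A : Matrix (Fin 5) (Fin 5) ℝ} {l₁ l₂ l₃ l₄ l₅ : ℝ}
    (h : ∀ r, A.charpoly.eval r = (r - l₁) * (r - l₂) * (r - l₃) * (r - l₄) * (r - l₅)) :
    HasSpectrum A {l₁, l₂, l₃, l₄, l₅} := by
  refine ⟨rfl, ?_⟩
  have hp : A.charpoly = (({l₁, l₂, l₃, l₄, l₅} : Multiset ℝ).map fun a => X - C a).prod :=
    Polynomial.funext fun r => by rw [h]; simp; ring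
  rw [hp, Polynomial.roots_multiset_prod_X_sub_C]

/-- Take `y = 0` and `P = 2x²`. The 3 × 3 block has determinant `-bP`, so `bP = -l₁γδ`; the other
coefficients give `s² = ab - αβ` and `t² = ab - (l₁γ + l₁δ + γδ) - P`. Then `|s| ≤ t` says that `P`
is at most the quantity in `hR`, which `hbR` states after multiplication by `b`. -/
theorem exists_bisymmetricFive_of_det_nonpos {a b α β l₁ γ δ : ℝ} (ha : 0 ≤ a) (hb : 0 ≤ b)
    (hS : a + b = -(α + β)) (hT : a + b = l₁ + γ + δ) (hdet : α * β ≤ a * b)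
    (hd : l₁ * γ * δ ≤ 0) (hR : 0 ≤ α * β - (l₁ * γ + l₁ * δ + γ * δ))
    (hbR : 0 ≤ b * (α * β - (l₁ * γ + l₁ * δ + γ * δ)) + l₁ * γ * δ) :
    ∃ A : Matrix (Fin 5) (Fin 5) ℝ, IsNonnegMatrix A ∧ IsBisymmetric A ∧
      ∀ r, A.charpoly.eval r = (r - α) * (r - β) * (r - l₁) * (r - γ) * (r - δ) := by
  obtain ⟨P, hP, hbP, hPR⟩ : ∃ P, 0 ≤ P ∧ b * P = -(l₁ * γ * δ) ∧
      P ≤ α * β - (l₁ * γ + l₁ * δ + γ * δ) := by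
    rcases hb.eq_or_lt with rfl | hb
    -- For `b = 0`, `hd` and `hbR` force `l₁γδ = 0`.
    · exact ⟨0, le_rfl, by linarith, hR⟩
    · refine ⟨-(l₁ * γ * δ) / b, div_nonneg (by linarith) hb.le, ?_, ?_⟩
      · field_simp
      · rw [div_le_iff₀ hb]
        linarith
  have hs := Real.sq_sqrt (sub_nonneg.2 hdet)
  have ht := Real.sq_sqrt (show 0 ≤ a * b - (l₁ * γ + l₁ * δ + γ * δ) - P by linarith)
  have hx := Real.sq_sqrt (show 0 ≤ P / 2 by linarith)
  refine ⟨bisymmetricFive a b √(a * b - α * β) √(a * b - (l₁ * γ + l₁ * δ + γ * δ) - P) √(P / 2) 0,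
    bisymmetricFive_isNonnegMatrix ha hb ?_ (Real.sqrt_nonneg _) le_rfl,
    bisymmetricFive_isBisymmetric .., fun r => ?_⟩
  · rw [abs_of_nonneg (Real.sqrt_nonneg _)]
    exact Real.sqrt_le_sqrt (by linarith)
  · rw [eval_charpoly_bisymmetricFive, hs, ht, hx]
    have e₁ : (r + a) * (r + b) - (a * b - α * β) = (r - α) * (r - β) := by
      linear_combination r * hS
    have e₂ : r * ((r - a) * (r - b) - (a * b - (l₁ * γ + l₁ * δ + γ * δ) - P))
        - 2 * (P / 2) * (r - b) - 2 * 0 ^ 2 * (r - a)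
        - 4 * √(P / 2) * 0 * √(a * b - (l₁ * γ + l₁ * δ + γ * δ) - P) =
        (r - l₁) * (r - γ) * (r - δ) := by
      linear_combination -r ^ 2 * hT + hbP
    rw [e₁, e₂]
    ring

theorem exists_bisymmetric_of_add_nonpos_of_sum_cubes_nonneg {l₁ l₂ l₃ l₄ l₅ : ℝ}
    (h₁₂ : l₂ ≤ l₁) (h₂₃ : l₃ ≤ l₂) (h₃₄ : l₄ ≤ l₃) (h₄₅ : l₅ ≤ l₄) (h₅₁ : -l₁ ≤ l₅)
    (hsum : l₁ + l₂ + l₃ + l₄ + l₅ = 0) (h₂₅ : l₂ + l₅ ≤ 0)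
    (hcubes : 0 ≤ l₁ ^ 3 + l₂ ^ 3 + l₃ ^ 3 + l₄ ^ 3 + l₅ ^ 3) :
    ∃ A : Matrix (Fin 5) (Fin 5) ℝ, IsNonnegMatrix A ∧ IsBisymmetric A ∧
      HasSpectrum A {l₁, l₂, l₃, l₄, l₅} := by
  suffices h : ∃ A : Matrix (Fin 5) (Fin 5) ℝ, IsNonnegMatrix A ∧ IsBisymmetric A ∧
      ∀ r, A.charpoly.eval r = (r - l₁) * (r - l₂) * (r - l₃) * (r - l₄) * (r - l₅) by
    obtain ⟨A, hA, hA', h⟩ := h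
    exact ⟨A, hA, hA', hasSpectrum_of_eval_charpoly h⟩
  have h₁ : 0 ≤ l₁ := by linarith
  have h₄ : l₄ ≤ 0 := by linarith
  have h₅ : l₅ ≤ 0 := by linarith
  obtain rfl : l₁ = -(l₂ + l₃ + l₄ + l₅) := by linarith
  rcases le_total 0 l₃ with h₃ | h₃
  · have h₃₄' : l₃ * l₄ ≤ 0 := mul_nonpos_of_nonneg_of_nonpos h₃ h₄
    obtain ⟨A, hA, hA', h⟩ := exists_bisymmetricFive_of_det_nonpos (a := 0) (b := -(l₂ + l₅))
      (α := l₂) (β := l₅) (l₁ := -(l₂ + l₃ + l₄ + l₅)) (γ := l₃) (δ := l₄) le_rfl (by linarith)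
      (by ring) (by ring)
      (by rw [zero_mul]; exact mul_nonpos_of_nonneg_of_nonpos (by linarith) h₅)
      (by rw [mul_assoc]; exact mul_nonpos_of_nonneg_of_nonpos h₁ h₃₄')
      (by
        have := mul_nonneg (show 0 ≤ -(l₂ + l₃ + l₄ + l₅) + l₂ by linarith)
          (show 0 ≤ -(l₂ + l₃ + l₄ + l₅) + l₅ by linarith)
        linarith)
      -- With `a = 0`, this quantity is exactly a third of the sum of cubes.
      (by linarith)
    exact ⟨A, hA, hA', fun r => by rw [h]; ring⟩
  rcases le_total 0 l₂ with h₂ | h₂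
  · have h₂₃' : l₂ * l₃ ≤ 0 := mul_nonpos_of_nonneg_of_nonpos h₂ h₃
    obtain ⟨A, hA, hA', h⟩ := exists_bisymmetricFive_of_det_nonpos (a := -l₄) (b := -l₅)
      (α := l₄) (β := l₅) (l₁ := -(l₂ + l₃ + l₄ + l₅)) (γ := l₂) (δ := l₃) (by linarith)
      (by linarith) (by ring) (by ring) (by rw [neg_mul_neg])
      (by rw [mul_assoc]; exact mul_nonpos_of_nonneg_of_nonpos h₁ h₂₃')
      (by
        have := mul_nonneg (show 0 ≤ -(l₂ + l₃ + l₄ + l₅) + l₄ by linarith)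
          (show 0 ≤ -(l₂ + l₃ + l₄ + l₅) + l₅ by linarith)
        linarith)
      -- Here `ab = αβ`, and the quantity is minus the cubic with roots `l₁, l₂, l₃` evaluated at `b
      -- = -l₅`, that is, `(l₁ + l₅)(l₂ + l₅)(l₃ + l₅)`.
      (by
        have := mul_nonneg (mul_nonneg (show 0 ≤ -(l₂ + l₃ + l₄ + l₅) + l₅ by linarith)
          (show 0 ≤ -(l₂ + l₅) by linarith)) (show 0 ≤ -(l₃ + l₅) by linarith)
        linarith)
    exact ⟨A, hA, hA', fun r => by rw [h]; ring⟩
  -- With `a = b` and `x = y`, the blocks split further: `-a ± s` are `l₄, l₅`, `a - t` is `l₂`, and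
  -- the remaining 2 × 2 block has trace `a + t = l₁ + l₃` and determinant `-4x² = l₁l₃`.
  · have hx := Real.sq_sqrt (mul_nonneg h₁ (neg_nonneg.2 h₃))
    refine ⟨bisymmetricFive (-(l₄ + l₅) / 2) (-(l₄ + l₅) / 2) ((l₄ - l₅) / 2)
      (-(l₄ + l₅) / 2 - l₂) (√(-(l₂ + l₃ + l₄ + l₅) * -l₃) / 2)
      (√(-(l₂ + l₃ + l₄ + l₅) * -l₃) / 2),
      bisymmetricFive_isNonnegMatrix (by linarith) (by linarith) ?_ (by positivity)
        (by positivity), bisymmetricFive_isBisymmetric .., fun r => ?_⟩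
    · rw [abs_of_nonneg (by linarith)]
      linarith
    · rw [eval_charpoly_bisymmetricFive]
      linear_combination (-(r - l₄) * (r - l₅) * (r - l₂)) * hx

theorem theorem3p3 (l₁ l₂ l₃ l₄ l₅ : ℝ)
    (h₁₂ : l₂ ≤ l₁) (h₂₃ : l₃ ≤ l₂) (h₃₄ : l₄ ≤ l₃) (h₄₅ : l₅ ≤ l₄) (h₅₁ : -l₁ ≤ l₅)
    (hsum : l₁ + l₂ + l₃ + l₄ + l₅ = 0) :
    ((∃ A : Matrix (Fin 5) (Fin 5) ℝ,
        IsNonnegMatrix A ∧ IsBisymmetric A ∧ HasSpectrum A {l₁, l₂, l₃, l₄, l₅}) ↔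
      (l₂ + l₅ ≤ 0 ∧ 0 ≤ l₁ ^ 3 + l₂ ^ 3 + l₃ ^ 3 + l₄ ^ 3 + l₅ ^ 3)) ∧
    ((∃ A : Matrix (Fin 5) (Fin 5) ℝ,
        IsNonnegMatrix A ∧ A.IsSymm ∧ HasSpectrum A {l₁, l₂, l₃, l₄, l₅}) ↔
      (l₂ + l₅ ≤ 0 ∧ 0 ≤ l₁ ^ 3 + l₂ ^ 3 + l₃ ^ 3 + l₄ ^ 3 + l₅ ^ 3)) := by
  have hsuff := exists_bisymmetric_of_add_nonpos_of_sum_cubes_nonneg h₁₂ h₂₃ h₃₄ h₄₅ h₅₁ hsum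
  refine ⟨⟨?_, fun ⟨h, h'⟩ => hsuff h h'⟩, ⟨?_, fun ⟨h, h'⟩ => ?_⟩⟩
  · rintro ⟨A, hA, hA', hs⟩
    exact add_nonpos_and_sum_cubes_nonneg h₁₂ h₂₃ h₃₄ h₄₅ hsum hA hA'.1 hs
  · rintro ⟨A, hA, hA', hs⟩
    exact add_nonpos_and_sum_cubes_nonneg h₁₂ h₂₃ h₃₄ h₄₅ hsum hA hA' hs
  · obtain ⟨A, hA, hA', hs⟩ := hsuff h h'
    exact ⟨A, hA, hA'.1, hs⟩
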